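/- Let $\Gamma$ be a finite, simple, connected graph with vertex set $V$, $n=|V|$, diameter $D\ge 1$, adjacency matrix $A$, and distance matrices $A_0,\dots,A_D$, where $(A_i)_{uv}=1$ if $\operatorname{dist}(u,v)=i$ and $(A_i)_{uv}=0$ otherwise. Let $\lambda_0>\lambda_1>\cdots>\lambda_d$ be the distinct eigenvalues of $A$, and let $\alpha$ be the positive eigenvector of $A$ for $\lambda_0$ with $\|\alpha\|^2=n$. Let $p_0,\dots,p_d$ (with $\deg p_i=i$) be the predistance polynomials, that is, the polynomials orthogonal with respect to $\langle p,q\rangle_\Gamma=\frac1n\operatorname{tr}(p(A)q(A))$ and normalized by $\langle p_i,p_i\rangle_\Gamma=p_i(\lambda_0)$, and put $p_{\ge D}=p_D+p_{D+1}+\cdots+p_d$. For a vertex $u$ let $\Gamma_i(u)$ be the set of vertices at distance $i$ from $u$; for $U\subseteq V$ let $\rho_U=\sum_{v\in U}\alpha_v e_v$, where $e_v$ is the coordinate vector of $v$; and let $$\delta^*_i=\frac1n\sum_{u\in V}\alpha_u^2\,\|\rho_{\Gamma_i(u)}\|^2 .$$ If $$\delta^*_D=p_{\ge D}(\lambda_0)\qquad\text{and}\qquad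 \delta^*_{D-1}=p_{D-1}(\lambda_0),$$ then $\Gamma$ is regular and $(D-1)$-partially distance-regular, i.e. $p_i(A)=A_i$ for every $0\le i\le D-1$. Moreover $\Gamma$ is distance-polynomial: each of $A_0,\dots,A_D$ is a polynomial in $A$ (with real coefficients). -/

import Mathlib

open Polynomial

namespace DistancePolynomial

variable {V : Type*} [Fintype V] [DecidableEq V] (G : SimpleGraph V) [DecidableRel G.Adj]

/-- The largest eigenvalue `λ₀` of the adjacency matrix. -/
noncomputable def lambda0 : ℝ := sSup (spectrum ℝ (G.adjMatrix ℝ))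

/-- The number `d`, where `d + 1` is the number of distinct eigenvalues. -/
noncomputable def dNum : ℕ := (spectrum ℝ (G.adjMatrix ℝ)).ncard - 1

/-- `α` is a positive eigenvector of `A` for the eigenvalue `λ₀`, with `‖α‖² = n`. -/
structure IsPerronVector (α : V → ℝ) : Prop where
  pos : ∀ u, 0 < α u
  eigen : (G.adjMatrix ℝ).mulVec α = lambda0 G • α
  norm_sq : ∑ u, α u ^ 2 = (Fintype.card V : ℝ)

theorem exists_eigenvector_lambda0 [Nonempty V] :
    ∃ x : V → ℝ, x ≠ 0 ∧ (G.adjMatrix ℝ).mulVec x = lambda0 G • x := by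
  have hA : (G.adjMatrix ℝ).IsHermitian := G.isHermitian_adjMatrix ℝ
  have hne : (spectrum ℝ (G.adjMatrix ℝ)).Nonempty := by
    rw [hA.spectrum_real_eq_range_eigenvalues]
    exact Set.range_nonempty _
  have hfin : (spectrum ℝ (G.adjMatrix ℝ)).Finite := by
    rw [hA.spectrum_real_eq_range_eigenvalues]
    exact Set.finite_range _
  have hmem : lambda0 G ∈ spectrum ℝ (G.adjMatrix ℝ) := hne.csSup_mem hfin
  rw [hA.spectrum_real_eq_range_eigenvalues] at hmem
  obtain ⟨i, hi⟩ := hmem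
  refine ⟨(hA.eigenvectorBasis i).ofLp, ?_, ?_⟩
  · intro h
    apply hA.eigenvectorBasis.orthonormal.ne_zero i
    ext v
    exact congrFun h v
  · rw [hA.mulVec_eigenvectorBasis i, hi]

theorem posSemidef_lambda0_sub : (lambda0 G • (1 : Matrix V V ℝ) - G.adjMatrix ℝ).PosSemidef := by
  have hA : (G.adjMatrix ℝ).IsHermitian := G.isHermitian_adjMatrix ℝ
  have hB : (lambda0 G • (1 : Matrix V V ℝ) - G.adjMatrix ℝ).IsHermitian := by
    refine Matrix.IsHermitian.sub ?_ hA
    ext i j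
    simp [Matrix.one_apply, eq_comm]
  have hfin : (spectrum ℝ (G.adjMatrix ℝ)).Finite := by
    rw [hA.spectrum_real_eq_range_eigenvalues]
    exact Set.finite_range _
  rw [hB.posSemidef_iff_eigenvalues_nonneg]
  intro i
  have h1 : hB.eigenvalues i ∈ spectrum ℝ (lambda0 G • (1 : Matrix V V ℝ) - G.adjMatrix ℝ) := by
    rw [hB.spectrum_real_eq_range_eigenvalues]
    exact ⟨i, rfl⟩
  generalize hB.eigenvalues i = t at h1
  rw [← Algebra.algebraMap_eq_smul_one, ← spectrum.singleton_sub_eq] at h1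
  obtain ⟨a, ha, b, hb, hab⟩ := h1
  have ha' : a = lambda0 G := ha
  have hle : b ≤ lambda0 G := le_csSup hfin.bddAbove hb
  have hab' : a - b = t := hab
  show (0 : ℝ) ≤ t
  linarith

/-- Every connected graph has a normalized Perron vector. -/
theorem exists_isPerronVector (hG : G.Connected) : ∃ α : V → ℝ, IsPerronVector G α := by
  have := hG.nonempty
  obtain ⟨x, hx0, hx⟩ := exists_eigenvector_lambda0 G
  have hpsd := posSemidef_lambda0_sub G
  have key : ∀ z : V → ℝ,
      star z ⬝ᵥ ((lambda0 G • (1 : Matrix V V ℝ) - G.adjMatrix ℝ).mulVec z)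
        = lambda0 G * ∑ u, z u * z u
          - ∑ u, ∑ v, z u * ((if G.Adj u v then (1 : ℝ) else 0) * z v) := by
    intro z
    rw [Matrix.sub_mulVec, Matrix.smul_mulVec, Matrix.one_mulVec, dotProduct_sub]
    simp only [dotProduct, Matrix.mulVec, star_trivial, Pi.smul_apply, smul_eq_mul,
      Finset.mul_sum, SimpleGraph.adjMatrix_apply]
    congr 1
    exact Finset.sum_congr rfl fun u _ => by ring
  have hx1 : star x ⬝ᵥ ((lambda0 G • (1 : Matrix V V ℝ) - G.adjMatrix ℝ).mulVec x) = 0 := by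
    rw [Matrix.sub_mulVec, Matrix.smul_mulVec, Matrix.one_mulVec, hx, sub_self, dotProduct_zero]
  set y : V → ℝ := fun u => |x u| with hy
  have hy1 : star y ⬝ᵥ ((lambda0 G • (1 : Matrix V V ℝ) - G.adjMatrix ℝ).mulVec y) = 0 := by
    refine le_antisymm ?_ (hpsd.dotProduct_mulVec_nonneg y)
    rw [← hx1, key, key]
    have e1 : ∑ u, y u * y u = ∑ u, x u * x u :=
      Finset.sum_congr rfl fun u _ => abs_mul_abs_self (x u)
    rw [e1]
    refine sub_le_sub_left (Finset.sum_le_sum fun u _ => Finset.sum_le_sum fun v _ => ?_) _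
    split_ifs
    · simp only [one_mul, hy, ← abs_mul]
      exact le_abs_self _
    · simp
  have hy2 : (G.adjMatrix ℝ).mulVec y = lambda0 G • y := by
    have h := (hpsd.dotProduct_mulVec_zero_iff y).1 hy1
    rw [Matrix.sub_mulVec, Matrix.smul_mulVec, Matrix.one_mulVec, sub_eq_zero] at h
    exact h.symm
  have hynn : ∀ u, 0 ≤ y u := fun u => abs_nonneg _
  have hstep : ∀ u v, G.Adj u v → y u = 0 → y v = 0 := by
    intro u v huv hu
    have h := congrFun hy2 u
    rw [SimpleGraph.adjMatrix_mulVec_apply, Pi.smul_apply, hu, smul_zero] at h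
    exact (Finset.sum_eq_zero_iff_of_nonneg fun w _ => hynn w).1 h v (by simpa using huv)
  have hwalk : ∀ u v, G.Walk u v → y u = 0 → y v = 0 := by
    intro u v w
    induction w with
    | nil => exact id
    | cons h _ ih => exact fun hu => ih (hstep _ _ h hu)
  have hypos : ∀ u, 0 < y u := by
    intro u
    refine lt_of_le_of_ne (hynn u) fun hu => hx0 ?_
    funext v
    obtain ⟨w⟩ := hG.preconnected u v
    exact abs_eq_zero.1 (hwalk u v w hu.symm)
  have hS : 0 < ∑ u, y u ^ 2 :=
    Finset.sum_pos (fun u _ => pow_pos (hypos u) 2) Finset.univ_nonempty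
  have hn : (0 : ℝ) < Fintype.card V := by exact_mod_cast Fintype.card_pos
  set c : ℝ := Real.sqrt ((Fintype.card V : ℝ) / ∑ u, y u ^ 2) with hc
  have hcpos : 0 < c := Real.sqrt_pos.2 (div_pos hn hS)
  refine ⟨c • y, fun u => mul_pos hcpos (hypos u), ?_, ?_⟩
  · rw [Matrix.mulVec_smul, hy2, smul_comm]
  · simp only [Pi.smul_apply, smul_eq_mul, mul_pow]
    rw [← Finset.mul_sum, hc, Real.sq_sqrt (div_pos hn hS).le, div_mul_cancel₀ _ hS.ne']

/-- The Perron vector `α` of a connected graph (the unique vector with `IsPerronVector`). -/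
noncomputable def perronVector (hG : G.Connected) : V → ℝ :=
  Classical.choose (exists_isPerronVector G hG)

/-- The scalar product `⟨p, q⟩_Γ = (1/n) tr (p(A) q(A))`. -/
noncomputable def polyInner (p q : ℝ[X]) : ℝ :=
  (1 / (Fintype.card V : ℝ)) * (aeval (G.adjMatrix ℝ) p * aeval (G.adjMatrix ℝ) q).trace

/-- The monic orthogonal polynomials `r₀, r₁, …` of `polyInner`: the Gram–Schmidt process applied
to `1, X, X², …`. They are meaningful for indices `k ≤ d`, where `polyInner` is definite. -/
noncomputable def monicOrtho (k : ℕ) : ℝ[X] :=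
  X ^ k - ∑ j : Fin k,
    C (polyInner G (X ^ k) (monicOrtho j.1) /
        polyInner G (monicOrtho j.1) (monicOrtho j.1)) * monicOrtho j.1
  termination_by k
  decreasing_by all_goals exact j.2

/-- The predistance polynomial `p_k` (`k ≤ d`): the multiple of `r_k` with
`‖p_k‖² = p_k(λ₀)`, that is `p_k = (r_k(λ₀) / ‖r_k‖²) r_k`. -/
noncomputable def predistPoly (k : ℕ) : ℝ[X] :=
  C ((monicOrtho G k).eval (lambda0 G) / polyInner G (monicOrtho G k) (monicOrtho G k)) *
    monicOrtho G k

/-- `p_{≥ j} = p_j + p_{j+1} + ⋯ + p_d`. -/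
noncomputable def predistPolyGE (j : ℕ) : ℝ[X] :=
  ∑ i ∈ Finset.Icc j (dNum G), predistPoly G i

/-- The set `Γ_i(u)` of vertices at distance `i` from `u`. -/
noncomputable def sphere (i : ℕ) (u : V) : Finset V := {v | G.dist u v = i}

/-- The distance matrix `A_i`. -/
noncomputable def distMatrix (i : ℕ) : Matrix V V ℝ :=
  Matrix.of fun u v => if G.dist u v = i then 1 else 0

/-- The vector `ρ_U = ∑_{v ∈ U} α_v e_v`. -/
noncomputable def rho (hG : G.Connected) (U : Finset V) : EuclideanSpace ℝ V :=
  ∑ v ∈ U, perronVector G hG v • EuclideanSpace.single v (1 : ℝ)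

/-- `δ*_i`, the arithmetic mean over the vertices `u` of the numbers `α_u² ‖ρ_{Γ_i(u)}‖²`. -/
noncomputable def deltaStar (hG : G.Connected) (i : ℕ) : ℝ :=
  (1 / (Fintype.card V : ℝ)) *
    ∑ u, perronVector G hG u ^ 2 * ‖rho G hG (sphere G i u)‖ ^ 2

/-- `m`-partial distance-regularity: `m ≤ D` and `p_i(A) = A_i` for all `i ≤ m`. -/
def IsPartiallyDistanceRegular (m : ℕ) : Prop :=
  m ≤ G.diam ∧ ∀ i ≤ m, aeval (G.adjMatrix ℝ) (predistPoly G i) = distMatrix G i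

/-- Every distance matrix `A_0, …, A_D` is a polynomial in the adjacency matrix. -/
def IsDistancePolynomial : Prop :=
  ∀ i ≤ G.diam, ∃ p : ℝ[X], aeval (G.adjMatrix ℝ) p = distMatrix G i

end DistancePolynomial

/-! Write `A*_i` for the matrix with entries `α_u α_v` at distance `i`. The Hoffman polynomial `p_0
+ ⋯ + p_d` takes the value `α αᵀ` at `A`, while `p_0 + ⋯ + p_{D-1}`, of degree below `D`, vanishes
at pairs at distance `D`. Hence `p_{≥D}(A)` agrees with `A*_D` at those pairs. Up to the factor `n`,
`δ*_D` and `p_{≥D}(λ₀) = ‖p_{≥D}‖²` are the sums of squared entries of `A*_D` and `p_{≥D}(A)`, so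
equality forces `p_{≥D}(A) = A*_D` (`aeval_eq_weightedDistMatrix`). What remains of `α αᵀ` is its
truncation to distances below `D`, and the same argument gives `p_{D-1}(A) = A*_{D-1}`.

The other layers follow by descent (`aeval_predistPoly_of_succ`). By orthogonality, `(x - λ₀)(p_0 +
⋯ + p_j)` is a combination of `r_{j+1}` and `r_j`. At `A`, both it and `r_{j+1}` vanish at distances
below `j`, hence so does `r_j`, which gives `p_j(A) = A*_j`.

At the bottom, `I = p_0(A) = A*_0` says `α_u² = 1`. Thus `α` is the all-one vector, the graph is
regular, and each `A*_i` is `A_i`. -/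

namespace DistancePolynomial

/-! ### Distances and weighted distance matrices -/

section

variable {V : Type*} (G : SimpleGraph V)

/-- The matrix with entries `α_u α_v` where `dist(u, v) = i`, and `0` elsewhere. -/
noncomputable def weightedDistMatrix (α : V → ℝ) (i : ℕ) : Matrix V V ℝ :=
  Matrix.of fun u v => if G.dist u v = i then α u * α v else 0

theorem weightedDistMatrix_apply (α : V → ℝ) (i : ℕ) (u v : V) :
    weightedDistMatrix G α i u v = if G.dist u v = i then α u * α v else 0 := rfl

variable {G}

theorem exists_dist_eq_of_le_diam (hG : G.Connected) {j : ℕ} (hj : j ≤ G.diam) :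
    ∃ u v, G.dist u v = j := by
  have := hG.nonempty
  obtain ⟨u, v, huv⟩ := G.exists_dist_eq_diam
  obtain ⟨w, hw⟩ := hG.exists_walk_length_eq_dist u v
  refine ⟨u, w.getVert j, le_antisymm ?_ ?_⟩
  · refine (SimpleGraph.dist_le (w.take j)).trans ?_
    rw [SimpleGraph.Walk.take_length]
    exact min_le_left _ _
  · have h1 := hG.dist_triangle (u := u) (v := w.getVert j) (w := v)
    have h2 := SimpleGraph.dist_le (w.drop j)
    rw [SimpleGraph.Walk.drop_length] at h2
    omega

theorem weightedDistMatrix_eq_distMatrix {α : V → ℝ} (hα : ∀ u, α u = 1) (i : ℕ) :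
    weightedDistMatrix G α i = distMatrix G i := by
  ext u v
  simp [weightedDistMatrix_apply, distMatrix, hα]

end

variable {V : Type*} [Fintype V] [DecidableEq V] (G : SimpleGraph V) [DecidableRel G.Adj]

/-! ### Polynomials in the adjacency matrix -/

theorem isSymm_aeval_adjMatrix (p : ℝ[X]) : (aeval (G.adjMatrix ℝ) p).IsSymm := by
  rw [aeval_eq_sum_range, Matrix.IsSymm, Matrix.transpose_sum]
  refine Finset.sum_congr rfl fun i _ => ?_
  rw [Matrix.transpose_smul, Matrix.transpose_pow, G.transpose_adjMatrix]

theorem aeval_mulVec_of_eigenvector {x : V → ℝ} {μ : ℝ}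
    (hx : (G.adjMatrix ℝ).mulVec x = μ • x) (p : ℝ[X]) :
    (aeval (G.adjMatrix ℝ) p).mulVec x = p.eval μ • x := by
  induction p using Polynomial.induction_on' with
  | add p q hp hq => rw [map_add, Matrix.add_mulVec, hp, hq, eval_add, add_smul]
  | monomial n a =>
    have hpow : ((G.adjMatrix ℝ) ^ n).mulVec x = μ ^ n • x := by
      induction n with
      | zero => simp
      | succ n ih =>
        rw [pow_succ, ← Matrix.mulVec_mulVec, hx, Matrix.mulVec_smul, ih, smul_smul, pow_succ,
          mul_comm]
    rw [aeval_monomial, eval_monomial, ← Algebra.smul_def, Matrix.smul_mulVec, hpow, smul_smul]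

/-- A polynomial of degree less than the distance of `u` and `v` has zero `(u, v)` entry at `A`. -/
theorem aeval_apply_eq_zero_of_degree_lt {p : ℝ[X]} {u v : V} (h : p.degree < G.dist u v) :
    aeval (G.adjMatrix ℝ) p u v = 0 := by
  rw [aeval_eq_sum_range, Matrix.sum_apply]
  refine Finset.sum_eq_zero fun i _ => ?_
  rw [Matrix.smul_apply, smul_eq_mul]
  by_cases hi : G.dist u v ≤ i
  · rw [(degree_lt_iff_coeff_zero _ _).1 h i hi, zero_mul]
  · rw [SimpleGraph.adjMatrix_pow_apply_eq_card_walk]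
    have : IsEmpty {p : G.Walk u v | p.length = i} :=
      ⟨fun w => hi (w.2 ▸ SimpleGraph.dist_le w.1)⟩
    rw [Fintype.card_eq_zero, Nat.cast_zero, mul_zero]

theorem finite_spectrum : (spectrum ℝ (G.adjMatrix ℝ)).Finite := by
  rw [(G.isHermitian_adjMatrix ℝ).spectrum_real_eq_range_eigenvalues]
  exact Set.finite_range _

theorem nonempty_spectrum [Nonempty V] : (spectrum ℝ (G.adjMatrix ℝ)).Nonempty := by
  rw [(G.isHermitian_adjMatrix ℝ).spectrum_real_eq_range_eigenvalues]
  exact Set.range_nonempty _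

theorem lambda0_mem_spectrum [Nonempty V] : lambda0 G ∈ spectrum ℝ (G.adjMatrix ℝ) :=
  (nonempty_spectrum G).csSup_mem (finite_spectrum G)

theorem card_spectrum [Nonempty V] : (finite_spectrum G).toFinset.card = dNum G + 1 := by
  have h := (Set.ncard_pos (finite_spectrum G)).2 (nonempty_spectrum G)
  rw [← Set.ncard_eq_toFinset_card _ (finite_spectrum G), dNum]
  omega

/-- Since `A` is symmetric, `p(A)` is determined by the values of `p` on the spectrum. -/
theorem aeval_eq_zero_iff (p : ℝ[X]) :
    aeval (G.adjMatrix ℝ) p = 0 ↔ ∀ μ ∈ spectrum ℝ (G.adjMatrix ℝ), p.eval μ = 0 := by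
  constructor
  · intro h μ hμ
    have hmem := spectrum.subset_polynomial_aeval (G.adjMatrix ℝ) p ⟨μ, hμ, rfl⟩
    have : Nontrivial (Matrix V V ℝ) := by
      by_contra hn
      rw [not_nontrivial_iff_subsingleton] at hn
      exact hμ (isUnit_of_subsingleton _)
    rw [h, spectrum.zero_eq] at hmem
    exact hmem
  · intro h
    have hA : IsSelfAdjoint (G.adjMatrix ℝ) := G.isHermitian_adjMatrix ℝ
    rw [← cfc_polynomial p (G.adjMatrix ℝ) hA,
      cfc_congr (g := fun _ => (0 : ℝ)) fun μ hμ => h μ hμ, cfc_const_zero]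

/-- Such a `p` would have `d + 1` distinct roots, the eigenvalues. This makes the scalar product
definite up to degree `d`. -/
theorem eq_zero_of_aeval_eq_zero [Nonempty V] {p : ℝ[X]}
    (hp : p.degree < (dNum G + 1 : ℕ)) (h : aeval (G.adjMatrix ℝ) p = 0) : p = 0 := by
  by_contra h0
  refine h0 (eq_zero_of_natDegree_lt_card_of_eval_eq_zero' p (finite_spectrum G).toFinset
    (fun μ hμ => (aeval_eq_zero_iff G p).1 h μ ((finite_spectrum G).mem_toFinset.1 hμ)) ?_)
  rw [card_spectrum]
  exact (natDegree_lt_iff_degree_lt h0).2 hp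

/-! ### The scalar product -/

theorem polyInner_comm (p q : ℝ[X]) : polyInner G p q = polyInner G q p := by
  rw [polyInner, Matrix.trace_mul_comm, polyInner]

/-- `⟨·, q⟩_Γ` as a linear functional. -/
noncomputable def polyInnerRight (q : ℝ[X]) : ℝ[X] →ₗ[ℝ] ℝ where
  toFun p := polyInner G p q
  map_add' p p' := by
    simp only [polyInner, map_add, add_mul, Matrix.trace_add, mul_add]
  map_smul' c p := by
    simp only [polyInner, map_smul, smul_mul_assoc, Matrix.trace_smul, smul_eq_mul,
      RingHom.id_apply]
    ring

theorem polyInnerRight_apply (p q : ℝ[X]) : polyInnerRight G q p = polyInner G p q := rfl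

theorem polyInner_smul_left (c : ℝ) (p q : ℝ[X]) :
    polyInner G (c • p) q = c * polyInner G p q :=
  (polyInnerRight G q).map_smul c p

theorem polyInner_smul_right (c : ℝ) (p q : ℝ[X]) :
    polyInner G p (c • q) = c * polyInner G p q := by
  rw [polyInner_comm, polyInner_smul_left, polyInner_comm]

theorem polyInner_mul_left (p q r : ℝ[X]) :
    polyInner G (p * q) r = polyInner G q (p * r) := by
  simp only [polyInner, ← map_mul]
  rw [mul_comm p q, mul_assoc]

theorem polyInner_one_one [Nonempty V] : polyInner G 1 1 = 1 := by
  simp [polyInner]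

/-- `p(A)` is symmetric, so the trace of its square is its squared Frobenius norm;
`card_mul_deltaStar` puts `δ*_i` on the same scale. -/
theorem card_mul_polyInner_self [Nonempty V] (p : ℝ[X]) :
    Fintype.card V * polyInner G p p = ∑ u, ∑ v, aeval (G.adjMatrix ℝ) p u v ^ 2 := by
  have hn : (Fintype.card V : ℝ) ≠ 0 := by exact_mod_cast Fintype.card_ne_zero
  rw [polyInner, ← mul_assoc, mul_one_div_cancel hn, one_mul, Matrix.trace]
  refine Finset.sum_congr rfl fun u _ => ?_
  rw [Matrix.diag_apply, Matrix.mul_apply]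
  exact Finset.sum_congr rfl fun v _ => by rw [(isSymm_aeval_adjMatrix G p).apply u v, sq]

theorem eq_zero_of_polyInner_self_eq_zero [Nonempty V] {p : ℝ[X]}
    (hp : p.degree < (dNum G + 1 : ℕ)) (h : polyInner G p p = 0) : p = 0 := by
  refine eq_zero_of_aeval_eq_zero G hp ?_
  have hs := card_mul_polyInner_self G p
  rw [h, mul_zero] at hs
  ext u v
  have hu := (Finset.sum_eq_zero_iff_of_nonneg
    fun u _ => Finset.sum_nonneg fun v _ => sq_nonneg _).1 hs.symm u (Finset.mem_univ u)
  exact pow_eq_zero_iff two_ne_zero |>.1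
    ((Finset.sum_eq_zero_iff_of_nonneg fun v _ => sq_nonneg _).1 hu v (Finset.mem_univ v))

/-! ### The monic orthogonal polynomials -/

/-- Gives both the degree and monicity. The projection coefficients play no role, so no bound `k ≤
d` is needed. -/
theorem degree_monicOrtho_sub_lt (k : ℕ) : (monicOrtho G k - X ^ k).degree < (k : WithBot ℕ) := by
  induction k using Nat.strong_induction_on with
  | _ k ih =>
    rw [monicOrtho, sub_sub_cancel_left, degree_neg]
    refine (degree_sum_le _ _).trans_lt ((Finset.sup_lt_iff (WithBot.bot_lt_coe k)).2 ?_)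
    intro j _
    have hj : (monicOrtho G j.1).degree ≤ j.1 := by
      rw [← sub_add_cancel (monicOrtho G j.1) (X ^ j.1)]
      exact (degree_add_le _ _).trans
        (max_le (ih j.1 j.2).le (degree_X_pow_le _))
    rw [← smul_eq_C_mul]
    exact ((degree_smul_le _ _).trans hj).trans_lt (Nat.cast_lt.2 j.2)

theorem degree_monicOrtho (k : ℕ) : (monicOrtho G k).degree = (k : WithBot ℕ) := by
  rw [← sub_add_cancel (monicOrtho G k) (X ^ k), degree_add_eq_right_of_degree_lt, degree_X_pow]
  rw [degree_X_pow]
  exact degree_monicOrtho_sub_lt G k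

theorem coeff_monicOrtho_self (k : ℕ) : (monicOrtho G k).coeff k = 1 := by
  have h := (degree_lt_iff_coeff_zero _ _).1 (degree_monicOrtho_sub_lt G k) k le_rfl
  rw [coeff_sub, coeff_X_pow_self] at h
  linarith

theorem monicOrtho_zero : monicOrtho G 0 = 1 := by
  rw [monicOrtho]
  simp

theorem polyInner_monicOrtho_self_ne_zero [Nonempty V] {k : ℕ} (hk : k ≤ dNum G) :
    polyInner G (monicOrtho G k) (monicOrtho G k) ≠ 0 := by
  intro h
  have h0 := eq_zero_of_polyInner_self_eq_zero G
    (by rw [degree_monicOrtho]; exact_mod_cast Nat.lt_succ_of_le hk) h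
  have := coeff_monicOrtho_self G k
  simp [h0] at this

theorem polyInner_monicOrtho_of_lt [Nonempty V] {j k : ℕ} (hjk : j < k) (hk : k ≤ dNum G) :
    polyInner G (monicOrtho G k) (monicOrtho G j) = 0 := by
  induction k using Nat.strong_induction_on generalizing j with
  | _ k ih =>
    rw [← polyInnerRight_apply, monicOrtho.eq_def G k, map_sub, map_sum,
      Finset.sum_eq_single ⟨j, hjk⟩]
    · rw [← smul_eq_C_mul, map_smul, polyInnerRight_apply, polyInnerRight_apply, smul_eq_mul,
        div_mul_cancel₀ _ (polyInner_monicOrtho_self_ne_zero G (hjk.le.trans hk)), sub_self]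
    · intro i _ hij
      rw [← smul_eq_C_mul, map_smul, polyInnerRight_apply, smul_eq_mul]
      rcases lt_trichotomy i.1 j with h | h | h
      · rw [polyInner_comm G (monicOrtho G i.1) (monicOrtho G j), ih j hjk h (hjk.le.trans hk),
          mul_zero]
      · exact absurd (Fin.ext h) hij
      · rw [ih i.1 i.2 h (i.2.le.trans hk), mul_zero]
    · exact fun h => absurd (Finset.mem_univ _) h

theorem polyInner_monicOrtho_of_ne [Nonempty V] {j k : ℕ} (hjk : j ≠ k) (hj : j ≤ dNum G)
    (hk : k ≤ dNum G) : polyInner G (monicOrtho G k) (monicOrtho G j) = 0 := by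
  rcases hjk.lt_or_gt with h | h
  · exact polyInner_monicOrtho_of_lt G h hk
  · rw [polyInner_comm, polyInner_monicOrtho_of_lt G h hj]

/-- A linear map that kills `r₀, …, r_{n-1}` kills every polynomial of degree less than `n`. -/
theorem map_eq_zero_of_degree_lt {M : Type*} [AddCommGroup M] [Module ℝ M] (f : ℝ[X] →ₗ[ℝ] M)
    {n : ℕ} (hf : ∀ j < n, f (monicOrtho G j) = 0) {p : ℝ[X]} (hp : p.degree < n) : f p = 0 := by
  induction n generalizing p with
  | zero =>
    have : p = 0 := by simpa [Nat.WithBot.lt_zero_iff] using hp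
    rw [this, map_zero]
  | succ n ih =>
    -- As `r_n` is monic of degree `n`, subtracting this multiple lowers the degree bound by one.
    rw [← sub_add_cancel p (p.coeff n • monicOrtho G n), map_add, map_smul, hf n n.lt_succ_self,
      smul_zero, add_zero]
    refine ih (fun j hj => hf j (hj.trans n.lt_succ_self)) ?_
    rw [degree_lt_iff_coeff_zero]
    intro m hm
    rw [coeff_sub, coeff_smul, smul_eq_mul]
    rcases hm.eq_or_lt with rfl | hm
    · rw [coeff_monicOrtho_self, mul_one, sub_self]
    · rw [(degree_lt_iff_coeff_zero _ _).1 hp m hm, (degree_lt_iff_coeff_zero (monicOrtho G n)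
        (n + 1)).1 (by rw [degree_monicOrtho]; exact_mod_cast n.lt_succ_self) m hm, mul_zero,
        sub_zero]

/-- The Fourier expansion of a polynomial in the monic orthogonal polynomials. -/
theorem eq_sum_monicOrtho [Nonempty V] {n : ℕ} (hn : n ≤ dNum G + 1) {p : ℝ[X]}
    (hp : p.degree < n) :
    p = ∑ i ∈ Finset.range n, (polyInner G p (monicOrtho G i) /
      polyInner G (monicOrtho G i) (monicOrtho G i)) • monicOrtho G i := by
  -- The identity minus the orthogonal projection; it kills each `r_j` with `j < n`.
  let f : ℝ[X] →ₗ[ℝ] ℝ[X] := LinearMap.id - ∑ i ∈ Finset.range n,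
    ((polyInner G (monicOrtho G i) (monicOrtho G i))⁻¹ •
      polyInnerRight G (monicOrtho G i)).smulRight (monicOrtho G i)
  have hfapp : ∀ q, f q = q - ∑ i ∈ Finset.range n, (polyInner G q (monicOrtho G i) /
      polyInner G (monicOrtho G i) (monicOrtho G i)) • monicOrtho G i := by
    intro q
    simp only [f, LinearMap.sub_apply, LinearMap.id_apply, LinearMap.sum_apply,
      LinearMap.smulRight_apply, LinearMap.smul_apply, polyInnerRight_apply, smul_eq_mul,
      div_eq_inv_mul]
  refine sub_eq_zero.1 ((hfapp p).symm.trans (map_eq_zero_of_degree_lt G f (fun j hj => ?_) hp))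
  rw [hfapp, Finset.sum_eq_single j, div_self (polyInner_monicOrtho_self_ne_zero G (by omega)),
    one_smul, sub_self]
  · intro i hi hij
    rw [Finset.mem_range] at hi
    rw [polyInner_monicOrtho_of_ne G hij (by omega) (by omega), zero_div, zero_smul]
  · exact fun h => absurd (Finset.mem_range.2 hj) h

/-! ### The Perron vector and the Hoffman polynomial -/

variable {G} in
/-- The eigenspace of `λ₀` is spanned by the Perron vector. -/
theorem IsPerronVector.exists_eq_smul {α : V → ℝ} (hα : IsPerronVector G α) (hG : G.Connected)
    {x : V → ℝ} (hx : (G.adjMatrix ℝ).mulVec x = lambda0 G • x) : ∃ c : ℝ, x = c • α := by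
  have := hG.nonempty
  -- With `c` the minimal ratio, `x - c α` is nonnegative and zero at `u₀`. The eigenvalue equation
  -- then spreads the zero along walks.
  obtain ⟨u₀, hu₀⟩ := Finite.exists_min fun u => x u / α u
  refine ⟨x u₀ / α u₀, ?_⟩
  set c := x u₀ / α u₀ with hc
  set y : V → ℝ := x - c • α with hy
  have hynn : ∀ u, 0 ≤ y u := fun u => by
    have := (le_div_iff₀ (hα.pos u)).1 (hu₀ u)
    simpa [hy] using this
  have hyeig : (G.adjMatrix ℝ).mulVec y = lambda0 G • y := by
    rw [hy, Matrix.mulVec_sub, Matrix.mulVec_smul, hx, hα.eigen, smul_sub, smul_comm]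
  have hwalk : ∀ u v, G.Walk u v → y u = 0 → y v = 0 := by
    intro u v w
    induction w with
    | nil => exact id
    | @cons a b _ h _ ih =>
      intro hu
      refine ih ?_
      have hs := congrFun hyeig a
      rw [SimpleGraph.adjMatrix_mulVec_apply, Pi.smul_apply, hu, smul_zero] at hs
      exact (Finset.sum_eq_zero_iff_of_nonneg fun w _ => hynn w).1 hs b (by simpa using h)
  have hy0 : y u₀ = 0 := by
    simp [hy, hc, div_mul_cancel₀ _ (hα.pos u₀).ne']
  funext v
  obtain ⟨w⟩ := hG.preconnected u₀ v
  exact sub_eq_zero.1 (hwalk u₀ v w hy0)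

variable {G} in
/-- A polynomial which vanishes at all eigenvalues but `λ₀`, where its value is `n`, has value
`α αᵀ` at `A`. -/
theorem IsPerronVector.aeval_eq_vecMulVec {α : V → ℝ} (hα : IsPerronVector G α)
    (hG : G.Connected) {h : ℝ[X]} (h0 : h.eval (lambda0 G) = Fintype.card V)
    (hne : ∀ μ ∈ spectrum ℝ (G.adjMatrix ℝ), μ ≠ lambda0 G → h.eval μ = 0) :
    aeval (G.adjMatrix ℝ) h = Matrix.vecMulVec α α := by
  have := hG.nonempty
  have hn : (Fintype.card V : ℝ) ≠ 0 := by exact_mod_cast Fintype.card_ne_zero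
  -- Hence each column of `h(A)` is in the `λ₀`-eigenspace, so is a multiple of `α`.
  have hzero : aeval (G.adjMatrix ℝ) ((X - C (lambda0 G)) * h) = 0 := by
    refine (aeval_eq_zero_iff G _).2 fun μ hμ => ?_
    rw [eval_mul, eval_sub, eval_X, eval_C]
    by_cases hμ0 : μ = lambda0 G
    · rw [hμ0, sub_self, zero_mul]
    · rw [hne μ hμ hμ0, mul_zero]
  set M := aeval (G.adjMatrix ℝ) h with hM
  have hAM : G.adjMatrix ℝ * M = lambda0 G • M := by
    rw [map_mul, map_sub, aeval_X, aeval_C, sub_mul, sub_eq_zero, ← Algebra.smul_def] at hzero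
    exact hzero
  have hcol : ∀ v, ∃ c : ℝ, (fun u => M u v) = c • α := fun v =>
    hα.exists_eq_smul hG (by
      funext u
      exact congrFun (congrFun hAM u) v)
  choose c hc using hcol
  have hMc : ∀ u v, M u v = c v * α u := fun u v => congrFun (hc v) u
  -- The multiples are found by computing `h(A) α = n α` through the symmetry of `h(A)`.
  have hMα : ∀ v, Fintype.card V * α v = Fintype.card V * c v := by
    intro v
    have h1 := congrFun (aeval_mulVec_of_eigenvector G hα.eigen h) v
    rw [h0, Pi.smul_apply, smul_eq_mul, ← hM] at h1
    rw [← h1, ← hα.norm_sq, Finset.sum_mul]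
    refine Finset.sum_congr rfl fun u _ => ?_
    have hvu : M v u = c v * α u := ((isSymm_aeval_adjMatrix G h).apply u v).trans (hMc u v)
    change M v u * α u = _
    rw [hvu]
    ring
  ext u v
  rw [hMc, ← mul_left_cancel₀ hn (hMα v), Matrix.vecMulVec_apply, mul_comm]

variable {G} in
-- The witness is `n` times the Lagrange basis polynomial of the spectrum at `λ₀`.
theorem IsPerronVector.exists_hoffman {α : V → ℝ} (hα : IsPerronVector G α)
    (hG : G.Connected) : ∃ h : ℝ[X], h.degree < (dNum G + 1 : ℕ) ∧
      aeval (G.adjMatrix ℝ) h = Matrix.vecMulVec α α := by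
  have := hG.nonempty
  have hmem := (finite_spectrum G).mem_toFinset.2 (lambda0_mem_spectrum G)
  have hinj : Set.InjOn (id : ℝ → ℝ) (finite_spectrum G).toFinset := Function.injective_id.injOn
  refine ⟨(Fintype.card V : ℝ) • Lagrange.basis (finite_spectrum G).toFinset id (lambda0 G),
    ?_, hα.aeval_eq_vecMulVec hG ?_ ?_⟩
  · refine (degree_smul_le _ _).trans_lt ?_
    rw [Lagrange.degree_basis hinj hmem, card_spectrum]
    exact Nat.cast_lt.2 (by omega)
  · have := Lagrange.eval_basis_self hinj hmem
    rw [eval_smul]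
    simpa using this
  · intro μ hμ hne
    have := Lagrange.eval_basis_of_ne (v := (id : ℝ → ℝ)) hne.symm
      ((finite_spectrum G).mem_toFinset.2 hμ)
    rw [eval_smul]
    simpa using this

variable {G} in
/-- The scalar product with a polynomial whose value at `A` is `α αᵀ` is evaluation at `λ₀`. -/
theorem IsPerronVector.polyInner_hoffman {α : V → ℝ} (hα : IsPerronVector G α) [Nonempty V]
    {h : ℝ[X]} (hh : aeval (G.adjMatrix ℝ) h = Matrix.vecMulVec α α) (q : ℝ[X]) :
    polyInner G h q = q.eval (lambda0 G) := by
  have hn : (Fintype.card V : ℝ) ≠ 0 := by exact_mod_cast Fintype.card_ne_zero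
  have hdot : α ⬝ᵥ α = Fintype.card V := by
    rw [← hα.norm_sq]
    exact Finset.sum_congr rfl fun u _ => (sq (α u)).symm
  rw [polyInner, Matrix.trace_mul_comm, hh, Matrix.mul_vecMulVec,
    aeval_mulVec_of_eigenvector G hα.eigen, Matrix.trace_vecMulVec, smul_dotProduct, hdot,
    smul_eq_mul]
  field_simp

/-! ### Predistance polynomials -/

theorem predistPoly_eq_smul (k : ℕ) : predistPoly G k =
    ((monicOrtho G k).eval (lambda0 G) / polyInner G (monicOrtho G k) (monicOrtho G k)) •
      monicOrtho G k := by
  rw [predistPoly, smul_eq_C_mul]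

theorem degree_predistPoly_le (k : ℕ) : (predistPoly G k).degree ≤ (k : WithBot ℕ) := by
  rw [predistPoly_eq_smul, ← degree_monicOrtho G k]
  exact degree_smul_le _ _

theorem predistPoly_zero [Nonempty V] : predistPoly G 0 = 1 := by
  simp [predistPoly, monicOrtho_zero, polyInner_one_one]

theorem polyInner_predistPoly_self [Nonempty V] {k : ℕ} (hk : k ≤ dNum G) :
    polyInner G (predistPoly G k) (predistPoly G k) = (predistPoly G k).eval (lambda0 G) := by
  have hr := polyInner_monicOrtho_self_ne_zero G hk
  rw [predistPoly_eq_smul, polyInner_smul_left, polyInner_smul_right, eval_smul, smul_eq_mul]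
  field_simp

theorem polyInner_predistPoly_of_ne [Nonempty V] {j k : ℕ} (hjk : j ≠ k) (hj : j ≤ dNum G)
    (hk : k ≤ dNum G) : polyInner G (predistPoly G j) (predistPoly G k) = 0 := by
  rw [predistPoly_eq_smul, predistPoly_eq_smul, polyInner_smul_left, polyInner_smul_right,
    polyInner_monicOrtho_of_ne G hjk.symm hk hj, mul_zero, mul_zero]

/-- Pythagoras, with `‖p_i‖² = p_i(λ₀)`. It turns the hypothesis on `δ*_D` into an equality of
norms. -/
theorem polyInner_sum_predistPoly_self [Nonempty V] {s : Finset ℕ} (hs : ∀ i ∈ s, i ≤ dNum G) :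
    polyInner G (∑ i ∈ s, predistPoly G i) (∑ i ∈ s, predistPoly G i) =
      (∑ i ∈ s, predistPoly G i).eval (lambda0 G) := by
  rw [← polyInnerRight_apply, map_sum, eval_finsetSum]
  refine Finset.sum_congr rfl fun i hi => ?_
  rw [polyInnerRight_apply, polyInner_comm, ← polyInnerRight_apply, map_sum,
    Finset.sum_eq_single i, polyInnerRight_apply, polyInner_predistPoly_self G (hs i hi)]
  · intro j hj hji
    exact polyInner_predistPoly_of_ne G hji (hs j hj) (hs i hi)
  · exact fun h => absurd hi h

/-- `p_0 + ⋯ + p_{m-1}`. -/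
noncomputable def predistPolyLT (m : ℕ) : ℝ[X] := ∑ i ∈ Finset.range m, predistPoly G i

theorem predistPolyLT_succ (m : ℕ) :
    predistPolyLT G (m + 1) = predistPolyLT G m + predistPoly G m :=
  Finset.sum_range_succ _ _

theorem degree_predistPolyLT_lt (m : ℕ) : (predistPolyLT G m).degree < (m : WithBot ℕ) := by
  refine (degree_sum_le _ _).trans_lt ((Finset.sup_lt_iff (WithBot.bot_lt_coe m)).2 ?_)
  intro j hj
  exact (degree_predistPoly_le G j).trans_lt (Nat.cast_lt.2 (Finset.mem_range.1 hj))

theorem predistPolyLT_add_predistPolyGE {m : ℕ} (hm : m ≤ dNum G + 1) :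
    predistPolyLT G m + predistPolyGE G m = predistPolyLT G (dNum G + 1) := by
  rw [predistPolyLT, predistPolyGE, predistPolyLT, ← Finset.Ico_succ_right_eq_Icc]
  exact Finset.sum_range_add_sum_Ico _ hm

/-- The reproducing property of `p_0 + ⋯ + p_{m-1}`. -/
theorem polyInner_predistPolyLT [Nonempty V] {m : ℕ} (hm : m ≤ dNum G + 1) {q : ℝ[X]}
    (hq : q.degree < (m : WithBot ℕ)) :
    polyInner G (predistPolyLT G m) q = q.eval (lambda0 G) := by
  conv_rhs => rw [eq_sum_monicOrtho G hm hq]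
  rw [predistPolyLT, ← polyInnerRight_apply, map_sum, eval_finsetSum]
  refine Finset.sum_congr rfl fun i _ => ?_
  rw [predistPoly_eq_smul, map_smul, polyInnerRight_apply, eval_smul,
    polyInner_comm G (monicOrtho G i) q, smul_eq_mul, smul_eq_mul]
  ring

variable {G} in
/-- The Hoffman polynomial `p_0 + ⋯ + p_d` has value `α αᵀ` at `A`. -/
theorem IsPerronVector.aeval_predistPolyLT {α : V → ℝ} (hα : IsPerronVector G α)
    (hG : G.Connected) :
    aeval (G.adjMatrix ℝ) (predistPolyLT G (dNum G + 1)) = Matrix.vecMulVec α α := by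
  have := hG.nonempty
  obtain ⟨h, hdeg, hh⟩ := hα.exists_hoffman hG
  rw [← hh]
  conv_rhs => rw [eq_sum_monicOrtho G le_rfl hdeg]
  -- The Fourier coefficients of `h` are `r_i(λ₀) / ‖r_i‖²`, exactly the scaling that defines `p_i`.
  simp only [hα.polyInner_hoffman hh, ← predistPoly_eq_smul]
  rfl

/-- `(x - λ₀)(p_0 + ⋯ + p_j)` is a combination of `r_j` and `r_{j+1}`. -/
theorem exists_sub_mul_predistPolyLT [Nonempty V] {j : ℕ} (hj : j + 1 ≤ dNum G) :
    ∃ a b : ℝ, (X - C (lambda0 G)) * predistPolyLT G (j + 1) =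
      a • monicOrtho G (j + 1) + b • monicOrtho G j := by
  have hdeg : ((X - C (lambda0 G)) * predistPolyLT G (j + 1)).degree <
      ((j + 2 : ℕ) : WithBot ℕ) := by
    rw [degree_mul, degree_X_sub_C]
    by_cases h0 : predistPolyLT G (j + 1) = 0
    · rw [h0, degree_zero, WithBot.add_bot]
      exact WithBot.bot_lt_coe _
    · have h1 := (natDegree_lt_iff_degree_lt h0).2 (degree_predistPolyLT_lt G (j + 1))
      rw [degree_eq_natDegree h0]
      exact_mod_cast (by omega : 1 + (predistPolyLT G (j + 1)).natDegree < j + 2)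
  have hsum := eq_sum_monicOrtho G (by omega) hdeg
  rw [Finset.sum_range_succ, Finset.sum_range_succ, Finset.sum_eq_zero, zero_add] at hsum
  · exact ⟨_, _, hsum.trans (add_comm _ _)⟩
  intro i hi
  rw [Finset.mem_range] at hi
  -- For `i < j` the factor `x - λ₀`, moved onto `r_i`, stays within reach of the reproducing
  -- property, which evaluates the product at its root `λ₀`.
  have hdi : ((X - C (lambda0 G)) * monicOrtho G i).degree < ((j + 1 : ℕ) : WithBot ℕ) := by
    rw [degree_mul, degree_X_sub_C, degree_monicOrtho]
    exact_mod_cast (by omega : 1 + i < j + 1)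
  rw [polyInner_mul_left, polyInner_predistPolyLT G (by omega) hdi, eval_mul, eval_sub, eval_X,
    eval_C, sub_self, zero_mul, zero_div, zero_smul]

/-! ### The numbers `δ*_i` -/

theorem isPerronVector_perronVector (hG : G.Connected) :
    IsPerronVector G (perronVector G hG) :=
  Classical.choose_spec (exists_isPerronVector G hG)

theorem norm_rho_sq (hG : G.Connected) (U : Finset V) :
    ‖rho G hG U‖ ^ 2 = ∑ v ∈ U, perronVector G hG v ^ 2 := by
  rw [EuclideanSpace.norm_sq_eq, ← Finset.sum_subset (Finset.subset_univ U)]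
  · refine Finset.sum_congr rfl fun v hv => ?_
    simp [rho, Finset.sum_apply, Pi.single_apply, hv]
  · intro v _ hv
    simp [rho, Finset.sum_apply, Pi.single_apply, hv]

theorem card_mul_deltaStar (hG : G.Connected) (i : ℕ) :
    Fintype.card V * deltaStar G hG i =
      ∑ u, ∑ v, weightedDistMatrix G (perronVector G hG) i u v ^ 2 := by
  have := hG.nonempty
  have hn : (Fintype.card V : ℝ) ≠ 0 := by exact_mod_cast Fintype.card_ne_zero
  rw [deltaStar, ← mul_assoc, mul_one_div_cancel hn, one_mul]
  refine Finset.sum_congr rfl fun u _ => ?_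
  rw [norm_rho_sq, sphere, Finset.sum_filter, Finset.mul_sum]
  refine Finset.sum_congr rfl fun v _ => ?_
  rw [weightedDistMatrix_apply]
  split_ifs
  · rw [mul_pow]
  · ring

/-- Equality in `δ*_j ≤ ‖p‖²`, where `p(A)` agrees with the weighted distance matrix at the pairs
of vertices at distance `j`. -/
theorem aeval_eq_weightedDistMatrix (hG : G.Connected) {p : ℝ[X]} {j : ℕ}
    (hp : ∀ u v, G.dist u v = j →
      aeval (G.adjMatrix ℝ) p u v = perronVector G hG u * perronVector G hG v)
    (hnorm : deltaStar G hG j = polyInner G p p) :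
    aeval (G.adjMatrix ℝ) p = weightedDistMatrix G (perronVector G hG) j := by
  have := hG.nonempty
  set W := weightedDistMatrix G (perronVector G hG) j with hW
  set M := aeval (G.adjMatrix ℝ) p with hM
  have hsum : ∑ u, ∑ v, (M u v - W u v) ^ 2 = 0 := by
    -- `W` is `M` restricted to the pairs at distance `j`, so the cross term is `W²` entrywise.
    have h1 : ∀ u v, (M u v - W u v) ^ 2 = M u v ^ 2 - W u v ^ 2 := by
      intro u v
      by_cases h : G.dist u v = j
      · rw [hp u v h, hW, weightedDistMatrix_apply, if_pos h]
        ring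
      · rw [hW, weightedDistMatrix_apply, if_neg h]
        ring
    simp only [h1, Finset.sum_sub_distrib]
    rw [hM, ← card_mul_polyInner_self, hW, ← card_mul_deltaStar, hnorm, sub_self]
  ext u v
  have hu := (Finset.sum_eq_zero_iff_of_nonneg
    fun u _ => Finset.sum_nonneg fun v _ => sq_nonneg _).1 hsum u (Finset.mem_univ u)
  exact sub_eq_zero.1 (pow_eq_zero_iff two_ne_zero |>.1
    ((Finset.sum_eq_zero_iff_of_nonneg fun v _ => sq_nonneg _).1 hu v (Finset.mem_univ v)))

/-! ### Truncations of `α αᵀ` and the descent -/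

variable {G}

/-- The diameter is at most `d`. -/
theorem diam_le_dNum (hG : G.Connected) : G.diam ≤ dNum G := by
  have := hG.nonempty
  obtain ⟨α, hα⟩ := exists_isPerronVector G hG
  obtain ⟨u, v, huv⟩ := G.exists_dist_eq_diam
  by_contra hlt
  -- If `d < D`, the Hoffman polynomial would vanish at a diametral pair, where `α αᵀ` is positive.
  have hdeg : (predistPolyLT G (dNum G + 1)).degree < (G.dist u v : WithBot ℕ) :=
    (degree_predistPolyLT_lt G _).trans_le (Nat.cast_le.2 (by omega))
  have h0 := aeval_apply_eq_zero_of_degree_lt G hdeg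
  rw [hα.aeval_predistPolyLT hG, Matrix.vecMulVec_apply] at h0
  exact (mul_pos (hα.pos u) (hα.pos v)).ne' h0

/-- `p(A)` is the truncation of `α αᵀ` to pairs at distance less than `m`. -/
def IsTruncation (α : V → ℝ) (p : ℝ[X]) (m : ℕ) : Prop :=
  ∀ u v, aeval (G.adjMatrix ℝ) p u v = if G.dist u v < m then α u * α v else 0

theorem IsTruncation.sub {α : V → ℝ} {p q : ℝ[X]} {m : ℕ}
    (h : IsTruncation (G := G) α (p + q) (m + 1))
    (hq : aeval (G.adjMatrix ℝ) q = weightedDistMatrix G α m) : IsTruncation (G := G) α p m := by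
  intro u v
  have h1 := h u v
  rw [map_add, Matrix.add_apply, hq, weightedDistMatrix_apply] at h1
  split_ifs at h1 ⊢ <;> first | omega | linarith

/-- If `(p_0 + ⋯ + p_j)(A)` is the truncation of `α αᵀ`, then `p_j(A)` has entries `α_u α_v` at
distance `j`. -/
theorem IsTruncation.aeval_predistPoly_apply {α : V → ℝ} {j : ℕ}
    (h : IsTruncation (G := G) α (predistPolyLT G (j + 1)) (j + 1)) {u v : V}
    (huv : G.dist u v = j) : aeval (G.adjMatrix ℝ) (predistPoly G j) u v = α u * α v := by
  have h1 := h u v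
  rw [predistPolyLT_succ, map_add, Matrix.add_apply, aeval_apply_eq_zero_of_degree_lt G
    (by rw [huv]; exact degree_predistPolyLT_lt G j), zero_add, if_pos (by omega)] at h1
  exact h1

/-- At distance less than `m`, the truncation of `α αᵀ` to distance at most `m` is annihilated by
`A - λ₀`. -/
theorem IsTruncation.aeval_sub_mul_apply {α : V → ℝ} (hα : IsPerronVector G α)
    (hG : G.Connected) {p : ℝ[X]} {m : ℕ} (h : IsTruncation (G := G) α p (m + 1)) {u v : V}
    (huv : G.dist u v < m) :
    aeval (G.adjMatrix ℝ) ((X - C (lambda0 G)) * p) u v = 0 := by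
  have h2 := congrFun hα.eigen u
  rw [SimpleGraph.adjMatrix_mulVec_apply, Pi.smul_apply, smul_eq_mul] at h2
  rw [map_mul, map_sub, aeval_X, aeval_C, sub_mul, ← Algebra.smul_def, Matrix.sub_apply,
    Matrix.smul_apply, smul_eq_mul, h u v, if_pos (by omega),
    SimpleGraph.adjMatrix_mul_apply, ← mul_assoc, ← h2, Finset.sum_mul, sub_eq_zero]
  refine Finset.sum_congr rfl fun w hw => ?_
  have hadj : G.Adj w u := ((SimpleGraph.mem_neighborFinset G u w).1 hw).symm
  -- Neighbours of `u` are at distance at most `m` from `v`, so the row sum sees only untruncated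
  -- entries and is that of `A α = λ₀ α`.
  have htri := hG.dist_triangle (u := w) (v := u) (w := v)
  rw [SimpleGraph.dist_eq_one_iff_adj.2 hadj] at htri
  rw [h w v, if_pos (by omega)]

/-- The backward step: `p_{j+1}(A)` and the sums `p_0 + ⋯ + p_j` determine `p_j(A)`. -/
theorem aeval_predistPoly_of_succ {α : V → ℝ} (hα : IsPerronVector G α) (hG : G.Connected)
    {j : ℕ} (hj : j + 1 ≤ G.diam)
    (htr : IsTruncation (G := G) α (predistPolyLT G (j + 1)) (j + 1))
    (hsucc : aeval (G.adjMatrix ℝ) (predistPoly G (j + 1)) = weightedDistMatrix G α (j + 1)) :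
    aeval (G.adjMatrix ℝ) (predistPoly G j) = weightedDistMatrix G α j := by
  have := hG.nonempty
  obtain ⟨a, b, hab⟩ := exists_sub_mul_predistPolyLT G (hj.trans (diam_le_dNum hG))
  set c := (monicOrtho G (j + 1)).eval (lambda0 G) /
    polyInner G (monicOrtho G (j + 1)) (monicOrtho G (j + 1)) with hc
  have hpc : predistPoly G (j + 1) = c • monicOrtho G (j + 1) := predistPoly_eq_smul G _
  have hc0 : c ≠ 0 := by
    intro h0
    obtain ⟨u, v, huv⟩ := exists_dist_eq_of_le_diam hG hj
    have h1 := congrFun (congrFun hsucc u) v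
    rw [hpc, h0, zero_smul, map_zero, Matrix.zero_apply, weightedDistMatrix_apply,
      if_pos huv] at h1
    exact (mul_pos (hα.pos u) (hα.pos v)).ne h1
  -- If `b = 0`, evaluation at `λ₀` forces `a = 0`, hence `p_0 + ⋯ + p_j = 0`, against the positive
  -- diagonal of the truncation.
  have hb : b ≠ 0 := by
    rintro rfl
    have hr : (monicOrtho G (j + 1)).eval (lambda0 G) ≠ 0 := fun h0 => hc0 (by
      rw [hc, h0, zero_div])
    have ha : a = 0 := by
      have h1 := congrArg (eval (lambda0 G)) hab
      rw [eval_mul, eval_sub, eval_X, eval_C, sub_self, zero_mul, zero_smul, add_zero, eval_smul,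
        smul_eq_mul, eq_comm, mul_eq_zero] at h1
      exact h1.resolve_right hr
    rw [ha, zero_smul, zero_smul, add_zero, mul_eq_zero] at hab
    have h0 := hab.resolve_left (X_sub_C_ne_zero _)
    obtain ⟨u⟩ := hG.nonempty
    have h1 := htr u u
    rw [h0, map_zero, Matrix.zero_apply, SimpleGraph.dist_self, if_pos j.succ_pos] at h1
    exact (mul_pos (hα.pos u) (hα.pos u)).ne h1
  ext u v
  rw [weightedDistMatrix_apply]
  rcases lt_trichotomy (G.dist u v) j with h | h | h
  -- The only case needing the two-term relation: its left side and `r_{j+1}(A)` both vanish here,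
  -- and `b ≠ 0`.
  · rw [if_neg h.ne, predistPoly_eq_smul, map_smul, Matrix.smul_apply, smul_eq_mul]
    have hr1 : aeval (G.adjMatrix ℝ) (monicOrtho G (j + 1)) u v = 0 := by
      have h1 := congrFun (congrFun hsucc u) v
      rw [hpc, map_smul, Matrix.smul_apply, smul_eq_mul, weightedDistMatrix_apply,
        if_neg (by omega), mul_eq_zero] at h1
      exact h1.resolve_left hc0
    have h2 := htr.aeval_sub_mul_apply hα hG h
    rw [hab, map_add, map_smul, map_smul, Matrix.add_apply, Matrix.smul_apply, Matrix.smul_apply,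
      hr1, smul_zero, zero_add, smul_eq_mul, mul_eq_zero] at h2
    rw [h2.resolve_left hb, mul_zero]
  · rw [if_pos h, htr.aeval_predistPoly_apply h]
  · rw [if_neg h.ne']
    exact aeval_apply_eq_zero_of_degree_lt G
      ((degree_predistPoly_le G j).trans_lt (Nat.cast_lt.2 h))

/-- Descent on `m`: removing the known layer `A*_m` from the truncation supplies the hypothesis for
the next step down. -/
theorem aeval_predistPoly_of_le {α : V → ℝ} (hα : IsPerronVector G α) (hG : G.Connected)
    {m : ℕ} (hm : m ≤ G.diam)
    (htr : IsTruncation (G := G) α (predistPolyLT G (m + 1)) (m + 1))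
    (hp : aeval (G.adjMatrix ℝ) (predistPoly G m) = weightedDistMatrix G α m) :
    ∀ i ≤ m, aeval (G.adjMatrix ℝ) (predistPoly G i) = weightedDistMatrix G α i := by
  induction m with
  | zero =>
    intro i hi
    rwa [Nat.le_zero.1 hi]
  | succ m ih =>
    have htr' : IsTruncation (G := G) α (predistPolyLT G (m + 1)) (m + 1) := by
      rw [predistPolyLT_succ] at htr
      exact htr.sub hp
    intro i hi
    rcases hi.eq_or_lt with rfl | hi
    · exact hp
    · exact ih (by omega) htr' (aeval_predistPoly_of_succ hα hG hm htr' hp) i (by omega)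

/-- If the Perron vector is the all-one vector, then the graph is regular. -/
theorem IsPerronVector.isRegular {α : V → ℝ} (hα : IsPerronVector G α) (h1 : ∀ u, α u = 1)
    [Nonempty V] : ∃ k : ℕ, G.IsRegularOfDegree k := by
  have hdeg : ∀ u, (G.degree u : ℝ) = lambda0 G := by
    intro u
    have h := congrFun hα.eigen u
    rw [SimpleGraph.adjMatrix_mulVec_apply, Pi.smul_apply, h1 u, smul_eq_mul, mul_one] at h
    simpa [h1] using h
  obtain ⟨u₀⟩ := ‹Nonempty V›
  exact ⟨G.degree u₀, fun u => by exact_mod_cast (hdeg u).trans (hdeg u₀).symm⟩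

end DistancePolynomial

/-! ### The main theorem -/

open DistancePolynomial

theorem mainTheorem3 {V : Type*} [Fintype V] [DecidableEq V] (G : SimpleGraph V)
    [DecidableRel G.Adj] (hG : G.Connected)
    (hD : DistancePolynomial.deltaStar G hG G.diam =
      (DistancePolynomial.predistPolyGE G G.diam).eval (DistancePolynomial.lambda0 G))
    (hD1 : DistancePolynomial.deltaStar G hG (G.diam - 1) =
      (DistancePolynomial.predistPoly G (G.diam - 1)).eval (DistancePolynomial.lambda0 G)) :
    (∃ k : ℕ, G.IsRegularOfDegree k) ∧
      DistancePolynomial.IsPartiallyDistanceRegular G (G.diam - 1) ∧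
      DistancePolynomial.IsDistancePolynomial G := by
  have := hG.nonempty
  have hα := isPerronVector_perronVector G hG
  set α := perronVector G hG with hαdef
  have hle := diam_le_dNum hG
  have hsplit := predistPolyLT_add_predistPolyGE G (hle.trans (dNum G).le_succ)
  have hdist : ∀ u v, G.dist u v ≤ G.diam := fun u v =>
    SimpleGraph.dist_le_diam (SimpleGraph.connected_iff_ediam_ne_top.1 hG)
  have hfull : IsTruncation (G := G) α (predistPolyLT G G.diam + predistPolyGE G G.diam)
      (G.diam + 1) := by
    intro u v
    rw [hsplit, hα.aeval_predistPolyLT hG, Matrix.vecMulVec_apply,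
      if_pos (Nat.lt_succ_of_le (hdist u v))]
  have hGE : aeval (G.adjMatrix ℝ) (predistPolyGE G G.diam) = weightedDistMatrix G α G.diam := by
    refine aeval_eq_weightedDistMatrix G hG (fun u v huv => ?_) ?_
    · have h := hfull u v
      rw [map_add, Matrix.add_apply, aeval_apply_eq_zero_of_degree_lt G
        (by rw [huv]; exact degree_predistPolyLT_lt G _), zero_add, if_pos (by omega)] at h
      exact h
    · rw [hD, predistPolyGE,
        polyInner_sum_predistPoly_self G fun i hi => (Finset.mem_Icc.1 hi).2]
  have htr : IsTruncation (G := G) α (predistPolyLT G G.diam) G.diam := hfull.sub hGE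
  have hlow : ∀ i ≤ G.diam - 1,
      aeval (G.adjMatrix ℝ) (predistPoly G i) = weightedDistMatrix G α i := by
    rcases Nat.eq_zero_or_pos G.diam with h0 | hpos
    -- For `D = 0` natural subtraction makes `D - 1` equal to `0`; the graph is a single vertex,
    -- with `α = 1`.
    · have hsub : Subsingleton V :=
        ⟨fun u v => hG.dist_eq_zero_iff.1 (Nat.le_zero.1 (h0 ▸ hdist u v))⟩
      intro i hi
      rw [show i = 0 by omega, predistPoly_zero, map_one]
      ext u v
      obtain rfl := Subsingleton.elim u v
      have hcard : Fintype.card V = 1 :=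
        Fintype.card_eq_one_iff.2 ⟨u, fun w => Subsingleton.elim w u⟩
      have hsq := hα.norm_sq
      rw [Fintype.sum_subsingleton _ u, hcard, Nat.cast_one, sq] at hsq
      rw [Matrix.one_apply_eq, weightedDistMatrix_apply, SimpleGraph.dist_self, if_pos rfl, hsq]
    · have htr' : IsTruncation (G := G) α (predistPolyLT G (G.diam - 1 + 1)) (G.diam - 1 + 1) := by
        rwa [Nat.sub_add_cancel hpos]
      refine aeval_predistPoly_of_le hα hG (Nat.sub_le _ _) htr' ?_
      refine aeval_eq_weightedDistMatrix G hG (fun u v huv => htr'.aeval_predistPoly_apply huv) ?_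
      rw [hD1, polyInner_predistPoly_self G (by omega)]
  -- The diagonal of `p_0(A) = I` reads `α_u² = 1`, and `α` is positive.
  have hone : ∀ u, α u = 1 := by
    intro u
    have h := congrFun (congrFun (hlow 0 (Nat.zero_le _)) u) u
    rw [predistPoly_zero, map_one, Matrix.one_apply_eq, weightedDistMatrix_apply,
      SimpleGraph.dist_self, if_pos rfl] at h
    nlinarith [hα.pos u]
  refine ⟨hα.isRegular hone, ⟨Nat.sub_le _ _, fun i hi => ?_⟩, fun i hi => ?_⟩
  · rw [hlow i hi, weightedDistMatrix_eq_distMatrix hone]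
  · rcases hi.eq_or_lt with rfl | hi
    · exact ⟨_, hGE.trans (weightedDistMatrix_eq_distMatrix hone _)⟩
    · exact ⟨_, (hlow i (by omega)).trans (weightedDistMatrix_eq_distMatrix hone _)⟩
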